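/- Let $k\ge 2$ and $d\ge 0$ be integers. A deterministic finite automaton with output consists of a finite set of states, an initial state, a transition for every pair of a state and a digit from $\{0,\dots,k-1\}$, and an output attached to every state. It generates the sequence $a=(a(n))_{n\ge 0}$ if for every $n\ge0$, after reading the base-$k$ expansion of $n$ from the initial state (most significant digit first, no leading zeros, the expansion of $0$ being the empty word), it stops in a state with output $a(n)$. Call $a$ a synchronizing $k$-automatic sequence if it is generated by such an automaton that has a synchronizing word, that is, a word $w$ over $\{0,\dots,k-1\}$ and a state $t$ such that reading $w$ from any state leads to $t$. (Equivalently, the minimal automaton generating $a$ has a synchronizing word.) Let $a$ be a synchronizing $k$-automatic sequence, and let $\mathcal P_d=\{P\in\mathbb Z[X] : \deg P\le d,\ P(\mathbb N)\subseteq\mathbb N\}$, where $\mathbb N=\{0,1,2,\dots\}$. Then for every $H\ge 0$ the set $$W_H=\bigl\{(a(P(n+\ell)))_{0\le \ell<H} : n\ge 0,\ P\in\mathcal P_d\bigr\}$$ is finite, and $$\lim_{H\to\infty}\frac1H\log \# W_H=0 .$$ -/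

import Mathlib

/-- A deterministic automaton with output: it reads letters from `α`, has states `σ`, and the state
in which it stops determines an output letter from `A`. -/
structure OutputAutomaton (α σ A : Type*) where
  step : σ → α → σ
  start : σ
  output : σ → A

/-- The state reached from the state `s` after reading the word `w` from left to right. -/
def OutputAutomaton.run {α σ A : Type*} (M : OutputAutomaton α σ A) (s : σ) (w : List α) : σ :=
  w.foldl M.step s

/-- `w` is a synchronizing word for `M`: it leads every state to one and the same state. -/
def OutputAutomaton.IsSynchronizingWord {α σ A : Type*} (M : OutputAutomaton α σ A)
    (w : List α) : Prop :=
  ∃ t : σ, ∀ s : σ, M.run s w = t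

/-- The base-`k` expansion of `n`, most significant digit first, without leading zeros
(so that `0` has the empty expansion). -/
def digitWord (k : ℕ) (hk : 2 ≤ k) (n : ℕ) : List (Fin k) :=
  ((Nat.digits k n).pmap Fin.mk (fun _ hd => Nat.digits_lt_base hk hd)).reverse

/-- `M` generates `a`: on input the base-`k` expansion of `n` the output of `M` is `a n`. -/
def OutputAutomaton.Generates {k : ℕ} {σ A : Type*} (M : OutputAutomaton (Fin k) σ A)
    (hk : 2 ≤ k) (a : ℕ → A) : Prop :=
  ∀ n : ℕ, M.output (M.run M.start (digitWord k hk n)) = a n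

/-- `a` is a synchronizing `k`-automatic sequence: it is generated by a finite automaton that has
a synchronizing word.

It makes no difference whether the automaton is moreover required to be the minimal one that
generates `a`: if some automaton that generates `a` is synchronizing, then so is the minimal one,
since it is a quotient of the accessible part (after adjoining, if need be, a new initial state
that is fixed by the digit `0` and follows the old initial state on all other digits; if `w` was
synchronizing, then `1w` still is). -/
def IsSynchronizingAutomatic {A : Type*} (k : ℕ) (hk : 2 ≤ k) (a : ℕ → A) : Prop :=
  ∃ (σ : Type) (_ : Finite σ) (M : OutputAutomaton (Fin k) σ A),
    M.Generates hk a ∧ ∃ w : List (Fin k), M.IsSynchronizingWord w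

/-- The integer polynomials of degree at most `d` that map `ℕ` to `ℕ`. -/
def natValuedPolynomials (d : ℕ) : Set (Polynomial ℤ) :=
  {P | P.degree ≤ (d : WithBot ℕ) ∧ ∀ n : ℕ, 0 ≤ P.eval (n : ℤ)}

/-- The set of all words `(a(P(n)), a(P(n+1)), …, a(P(n+H-1)))` with `n ≥ 0` and `P` an integer
polynomial of degree at most `d` that maps `ℕ` to `ℕ` (so that `Int.toNat` only reads the
nonnegative integer `P(n+ℓ)` as a natural number). -/
def polynomialSubwords {A : Type*} (a : ℕ → A) (d H : ℕ) : Set (Fin H → A) :=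
  {w | ∃ n : ℕ, ∃ P ∈ natValuedPolynomials d,
    w = fun ℓ : Fin H => a (P.eval ((n + (ℓ : ℕ) : ℕ) : ℤ)).toNat}

/-! Once a synchronizing block has been read, only the digits after it matter. So if the block
occurs among the last `2j` digits of `N`, the state at `N` depends only on `N` modulo `K = k^(2j)`.

For nonconstant `P`, write `P = c + k^M Q` with `c < k^M` and some nonconstant coefficient of `Q`
not divisible by `k`. The low digits `c` act by one of finitely many maps `F : σ → σ`, and `Q`
modulo `K` is periodic with period `K`. Hence `F` and `Q` modulo `K` determine the word except where
`Q(n)` lacks the block. If at most `δK` residues are exceptional, uniformly in `P`, there are at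
most a constant times `|σ|^((H/K+1)δK)` words (`ncard_periodicWords_le`), and `δ` is arbitrary.

The uniform bound is `card_not_hasBlock_le`. Put `n = u + k^j v`; then `Q(n) ≡ Q(u) + k^j v Q'(u)`
modulo `k^(2j)`. For some prime `p ∣ k`, `Q'` is not divisible by `p^(k+d)`, so few `u` make `Q'(u)`
divisible by a high power of `p`. For the other `u` the progression in `v` is spread evenly enough
that its top digits rarely avoid the block. -/

/-! ### Automata reading expansions -/

theorem digitWord_mul_add {k : ℕ} (hk : 2 ≤ k) {n c : ℕ} (hc : c < k) (h : k * n + c ≠ 0) :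
    digitWord k hk (k * n + c) = digitWord k hk n ++ [⟨c, hc⟩] := by
  apply List.map_injective_iff.2 Fin.val_injective
  have hval : ∀ m, (digitWord k hk m).map Fin.val = (Nat.digits k m).reverse := by
    intro m
    simp [digitWord, List.map_pmap]
  rw [List.map_append, hval, hval, Nat.digits_def' (by omega) (Nat.pos_of_ne_zero h),
    Nat.mul_add_mod, Nat.mod_eq_of_lt hc, Nat.mul_add_div (by omega), Nat.div_eq_of_lt hc]
  simp

/-- Reading the digit `c` after the expansion of `n`, with an additional initial state `none` that is
fixed by the digit `0`. -/
def OutputAutomaton.extendedStep {k : ℕ} {σ A : Type*} (M : OutputAutomaton (Fin k) σ A) :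
    Option σ → Fin k → Option σ
  | none, c => if (c : ℕ) = 0 then none else some (M.step M.start c)
  | some s, c => some (M.step s c)

/-- The state reached by the expansion of `n`, with an additional initial state `none`. -/
def OutputAutomaton.extendedState {k : ℕ} {σ A : Type*} (M : OutputAutomaton (Fin k) σ A)
    (hk : 2 ≤ k) (n : ℕ) : Option σ :=
  if n = 0 then none else some (M.run M.start (digitWord k hk n))

theorem OutputAutomaton.extendedState_mul_add {k : ℕ} {σ A : Type*}
    (M : OutputAutomaton (Fin k) σ A) (hk : 2 ≤ k) (n : ℕ) (c : Fin k) :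
    M.extendedState hk (k * n + c) = M.extendedStep (M.extendedState hk n) c := by
  by_cases h : k * n + c = 0
  · have hc : (c : ℕ) = 0 := by omega
    have hn : n = 0 := by
      rcases Nat.mul_eq_zero.1 (show k * n = 0 by omega) with h | h <;> omega
    subst hn
    simp [extendedState, extendedStep, hc]
  · have hd := digitWord_mul_add hk c.2 h
    by_cases hn : n = 0
    · subst hn
      have hc : (c : ℕ) ≠ 0 := by omega
      rw [extendedState, if_neg h, hd]
      simp [extendedState, extendedStep, hc, digitWord, run]
    · rw [extendedState, if_neg h, hd]
      simp [extendedState, extendedStep, hn, run]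

/-- Here `c` is the value of `w`. Leading zeros of `w` do no harm at `n = 0`, because `none` is
fixed by the digit `0`. -/
theorem OutputAutomaton.extendedState_append {k : ℕ} {σ A : Type*}
    (M : OutputAutomaton (Fin k) σ A) (hk : 2 ≤ k) (w : List (Fin k)) :
    ∃ c < k ^ w.length, ∀ n,
      M.extendedState hk (k ^ w.length * n + c) = w.foldl M.extendedStep (M.extendedState hk n) := by
  induction w with
  | nil => exact ⟨0, by simp, by simp⟩
  | cons x w ih =>
    obtain ⟨c, hc, h⟩ := ih
    refine ⟨k ^ w.length * x + c, ?_, fun n => ?_⟩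
    · calc k ^ w.length * x + c < k ^ w.length * (x + 1) := by rw [mul_add]; omega
        _ ≤ k ^ w.length * k := Nat.mul_le_mul_left _ x.2
        _ = _ := by rw [List.length_cons, pow_succ]
    · rw [List.foldl_cons, ← M.extendedState_mul_add hk, ← h, List.length_cons]
      congr 1
      ring

/-! ### Synchronization through a block of digits -/

/-- `S` is computed by reading base-`k` digits, and reading the expansion `c₀` of length `L` resets
the state. -/
structure IsSynchronizedBy {σ : Type*} (k : ℕ) (S : ℕ → σ) (L c₀ : ℕ) : Prop where
  lt : c₀ < k ^ L
  step : ∃ f : σ → ℕ → σ, ∀ n c, c < k → S (k * n + c) = f (S n) c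
  reset : ∃ t, ∀ n, S (k ^ L * n + c₀) = t

theorem IsSynchronizingAutomatic.exists_isSynchronizedBy {A : Type*} {k : ℕ} {hk : 2 ≤ k}
    {a : ℕ → A} (ha : IsSynchronizingAutomatic k hk a) :
    ∃ (σ : Type) (_ : Finite σ) (S : ℕ → σ) (out : σ → A) (L c₀ : ℕ),
      IsSynchronizedBy k S L c₀ ∧ ∀ n, out (S n) = a n := by
  obtain ⟨σ, hσ, M, hM, w, t, ht⟩ := ha
  -- The prepended digit `1` forces the run out of `none`, after which `w` synchronizes.
  obtain ⟨c, hc, h⟩ := M.extendedState_append hk (⟨1, hk⟩ :: w)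
  refine ⟨Option σ, inferInstance, M.extendedState hk,
    fun o => o.elim (M.output M.start) M.output, _, c, ⟨hc, ?_, some t, fun n => ?_⟩, fun n => ?_⟩
  · refine ⟨fun s c => if hc : c < k then M.extendedStep s ⟨c, hc⟩ else s, fun n c hc => ?_⟩
    simpa [hc] using M.extendedState_mul_add hk n ⟨c, hc⟩
  · have hsome : ∀ (w : List (Fin k)) (s : σ),
        w.foldl M.extendedStep (some s) = some (M.run s w) := by
      intro w
      induction w with
      | nil => intro s; rfl
      | cons x w ih => intro s; exact ih _
    rw [h, List.foldl_cons]
    cases M.extendedState hk n with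
    | none => simp [OutputAutomaton.extendedStep, hsome, ht]
    | some s => simp [OutputAutomaton.extendedStep, hsome, ht]
  · rw [← hM n]
    by_cases hn : n = 0
    · simp [OutputAutomaton.extendedState, hn, digitWord, OutputAutomaton.run]
    · simp [OutputAutomaton.extendedState, hn]

theorem IsSynchronizedBy.exists_append {σ : Type*} {k L c₀ : ℕ} {S : ℕ → σ}
    (hS : IsSynchronizedBy k S L c₀) (m : ℕ) :
    ∀ c < k ^ m, ∃ F : σ → σ, ∀ n, S (k ^ m * n + c) = F (S n) := by
  obtain ⟨f, hf⟩ := hS.step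
  induction m with
  | zero =>
    intro c hc
    obtain rfl : c = 0 := by simpa using hc
    exact ⟨id, by simp⟩
  | succ m ih =>
    intro c hc
    have hk : 0 < k := by
      rcases Nat.eq_zero_or_pos k with rfl | h
      · simp at hc
      · exact h
    obtain ⟨F, hF⟩ := ih (c / k) (Nat.div_lt_of_lt_mul (by rwa [pow_succ'] at hc))
    refine ⟨fun s => f (F s) (c % k), fun n => ?_⟩
    beta_reduce
    rw [← hF, ← hf _ _ (Nat.mod_lt _ hk)]
    congr 1
    conv_lhs => rw [← Nat.div_add_mod c k]
    ring

/-- The block `c₀` of length `L` occurs among the last `m` base-`k` digits of `N`. -/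
def HasBlock (k L c₀ m N : ℕ) : Prop :=
  ∃ i, i + L ≤ m ∧ N / k ^ i % k ^ L = c₀

theorem HasBlock.congr {k L c₀ m N N' : ℕ} (h : HasBlock k L c₀ m N)
    (hN : N % k ^ m = N' % k ^ m) : HasBlock k L c₀ m N' := by
  obtain ⟨i, hi, h⟩ := h
  refine ⟨i, hi, ?_⟩
  rw [← h, ← Nat.mod_mul_right_div_self, ← Nat.mod_mul_right_div_self, ← pow_add,
    ← Nat.mod_mod_of_dvd N (pow_dvd_pow k hi), ← Nat.mod_mod_of_dvd N' (pow_dvd_pow k hi), hN]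

/-- The block resets the state to `t` whatever precedes it; the `i` digits below it agree and act by
the same map `F`. -/
theorem IsSynchronizedBy.eq_of_hasBlock {σ : Type*} {k L c₀ m N N' : ℕ} {S : ℕ → σ} (hk : 0 < k)
    (hS : IsSynchronizedBy k S L c₀) (h : HasBlock k L c₀ m N)
    (hN : N % k ^ m = N' % k ^ m) : S N = S N' := by
  obtain ⟨i, hi, h⟩ := h
  have h' : N' / k ^ i % k ^ L = c₀ := by
    rw [← h, ← Nat.mod_mul_right_div_self, ← Nat.mod_mul_right_div_self, ← pow_add,
      ← Nat.mod_mod_of_dvd N (pow_dvd_pow k hi), ← Nat.mod_mod_of_dvd N' (pow_dvd_pow k hi), hN]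
  obtain ⟨t, ht⟩ := hS.reset
  have hz : N % k ^ i = N' % k ^ i := by
    rw [← Nat.mod_mod_of_dvd N (pow_dvd_pow k (show i ≤ m by omega)), hN,
      Nat.mod_mod_of_dvd N' (pow_dvd_pow k (show i ≤ m by omega))]
  obtain ⟨F, hF⟩ := hS.exists_append i (N % k ^ i) (Nat.mod_lt _ (pow_pos hk i))
  have key : ∀ x, x / k ^ i % k ^ L = c₀ → x % k ^ i = N % k ^ i → S x = F t := by
    intro x hx hxz
    rw [← Nat.div_add_mod x (k ^ i), hxz, hF, ← Nat.div_add_mod (x / k ^ i) (k ^ L), hx, ht]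
  rw [key N h rfl, key N' h' hz.symm]

/-! ### Polynomial values divisible by high prime powers -/

theorem Prime.pow_dvd_right_of_not_pow_dvd_left {M : Type*} [CommMonoidWithZero M] [IsCancelMulZero M]
    {p : M} (hp : Prime p) {n h : ℕ} {x y : M} (hx : ¬ p ^ h ∣ x) (hxy : p ^ (n + h) ∣ x * y) :
    p ^ n ∣ y := by
  induction h generalizing x with
  | zero => simp at hx
  | succ h ih =>
    by_cases hpx : p ∣ x
    · obtain ⟨x, rfl⟩ := hpx
      rw [pow_succ', mul_dvd_mul_iff_left hp.ne_zero] at hx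
      rw [← add_assoc, pow_succ', mul_assoc, mul_dvd_mul_iff_left hp.ne_zero] at hxy
      exact ih hx hxy
    · exact (pow_dvd_pow p (Nat.le_add_right n _)).trans (hp.pow_dvd_of_dvd_mul_left _ hpx hxy)

open Polynomial in
/-- A polynomial that is not divisible by `p ^ r` is divisible by a high power of `p` in few residue
classes. -/
theorem card_le_of_pow_dvd_eval {p : ℤ} (hp : Prime p) (r h : ℕ) (D : ℕ) :
    ∀ R : ℤ[X], R.natDegree ≤ D → ¬ C (p ^ r) ∣ R → ∀ U : Finset ℤ,
      (∀ u ∈ U, ∀ v ∈ U, p ^ h ∣ u - v → u = v) →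
      (∀ u ∈ U, p ^ (r + h * D) ∣ R.eval u) → U.card ≤ D := by
  induction D with
  | zero =>
    intro R hR hr U _ hU
    rw [Nat.le_zero, Finset.card_eq_zero, Finset.eq_empty_iff_forall_notMem]
    intro u hu
    have := hU u hu
    rw [eq_C_of_natDegree_le_zero hR] at hr this
    rw [eval_C, mul_zero, add_zero] at this
    exact hr (map_dvd C this)
  | succ D ih =>
    intro R hR hr U hinj hU
    rcases U.eq_empty_or_nonempty with rfl | ⟨u₀, hu₀⟩
    · simp
    -- Divide by `X - u₀`. For the other `u`, the factor `u - u₀` absorbs fewer than `h` powers of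
    -- `p`, so the exponent drops by only `h` as the degree drops by one.
    have hdiv : R = C (R.eval u₀) + (X - C u₀) * (R /ₘ (X - C u₀)) := by
      rw [← modByMonic_X_sub_C_eq_C_eval, modByMonic_add_div]
    have hcard : (U.erase u₀).card ≤ D := by
      refine ih (R /ₘ (X - C u₀)) ?_ ?_ _ ?_ ?_
      · rw [natDegree_divByMonic _ (monic_X_sub_C u₀), natDegree_X_sub_C]
        omega
      · intro hdvd
        apply hr
        rw [hdiv]
        exact dvd_add (map_dvd C ((pow_dvd_pow p (Nat.le_add_right _ _)).trans (hU u₀ hu₀)))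
          (hdvd.mul_left _)
      · intro u hu v hv
        exact hinj u (Finset.mem_of_mem_erase hu) v (Finset.mem_of_mem_erase hv)
      · intro u hu
        have hne : ¬ p ^ h ∣ u - u₀ := fun hd =>
          Finset.ne_of_mem_erase hu (hinj u (Finset.mem_of_mem_erase hu) u₀ hu₀ hd)
        have hprod : p ^ (r + h * D + h) ∣ (u - u₀) * (R /ₘ (X - C u₀)).eval u := by
          have h1 := hU u (Finset.mem_of_mem_erase hu)
          have h2 := congrArg (eval u) hdiv
          simp only [eval_add, eval_C, eval_mul, eval_sub, eval_X] at h2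
          rw [show (u - u₀) * (R /ₘ (X - C u₀)).eval u = R.eval u - R.eval u₀ by
            rw [h2]; ring]
          rw [show r + h * D + h = r + h * (D + 1) by ring]
          exact dvd_sub h1 (hU u₀ hu₀)
        exact hp.pow_dvd_right_of_not_pow_dvd_left hne hprod
    rw [Finset.card_erase_of_mem hu₀] at hcard
    omega

-- Representatives of the residue classes modulo `p ^ h` that are hit number at most `D`, and each
-- class has `n / p ^ h` elements in the range.
open Polynomial in
theorem card_filter_pow_dvd_eval_le {p : ℕ} (hp : p.Prime) (r h D n : ℕ) {R : ℤ[X]}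
    (hR : R.natDegree ≤ D) (hr : ¬ C ((p : ℤ) ^ r) ∣ R) (hn : p ^ h ∣ n) :
    ((Finset.range n).filter fun u : ℕ => (p : ℤ) ^ (r + h * D) ∣ R.eval (u : ℤ)).card * p ^ h
      ≤ D * n := by
  obtain ⟨N, rfl⟩ := hn
  set B := (Finset.range (p ^ h * N)).filter fun u : ℕ => (p : ℤ) ^ (r + h * D) ∣ R.eval (u : ℤ)
    with hB
  have hpos : 0 < p ^ h := pow_pos hp.pos h
  have hfiber : B.card ≤ N * (B.image (· % p ^ h)).card := by
    refine Finset.card_le_mul_card_image B N fun b _ => ?_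
    refine (Finset.card_le_card_of_injOn (t := Finset.range N) (· / p ^ h) ?_ ?_).trans
      (Finset.card_range N).le
    · intro x hx
      have hx' : x < p ^ h * N := by
        simp only [hB, Finset.coe_filter, Finset.mem_filter, Finset.mem_range, Set.mem_ofPred_eq] at hx
        exact hx.1.1
      simpa using Nat.div_lt_of_lt_mul hx'
    · intro x hx y hy hxy
      simp only [Finset.coe_filter, Set.mem_ofPred_eq] at hx hy hxy
      rw [← Nat.div_add_mod x (p ^ h), ← Nat.div_add_mod y (p ^ h), hxy, hx.2, hy.2]
  have himage : (B.image (· % p ^ h)).card ≤ D := by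
    choose! g hg using fun c (hc : c ∈ B.image (· % p ^ h)) => Finset.mem_image.1 hc
    have hginj : Set.InjOn (fun c => (g c : ℤ)) (B.image (· % p ^ h)) := by
      intro c hc c' hc' hcc
      rw [← (hg c hc).2, ← (hg c' hc').2, Nat.cast_injective hcc]
    rw [← Finset.card_image_of_injOn hginj]
    refine card_le_of_pow_dvd_eval (Nat.prime_iff_prime_int.1 hp) r h D R hR hr _ ?_ ?_
    · intro u hu v hv huv
      obtain ⟨c, hc, rfl⟩ := Finset.mem_image.1 hu
      obtain ⟨c', hc', rfl⟩ := Finset.mem_image.1 hv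
      have : g c' ≡ g c [MOD p ^ h] := by
        rw [Nat.modEq_iff_dvd]
        exact_mod_cast huv
      have hcc : c' = c := by rw [← (hg c hc).2, ← (hg c' hc').2]; exact this
      simp only [hcc]
    · intro u hu
      obtain ⟨c, hc, rfl⟩ := Finset.mem_image.1 hu
      exact (Finset.mem_filter.1 (hg c hc).1).2
  calc B.card * p ^ h ≤ N * D * p ^ h :=
        Nat.mul_le_mul_right _ (hfiber.trans (Nat.mul_le_mul_left _ himage))
    _ = D * (p ^ h * N) := by ring

/-! ### Progressions and digit blocks -/

/-- The values of an arithmetic progression modulo `m ^ 2` that lie in a given interval. -/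
theorem card_filter_progression_le {m : ℕ} (hm : 0 < m) (f : ℕ → ℕ) (c g : ℤ)
    (hf : ∀ v, (f v : ℤ) ≡ c + m * (v * g) [ZMOD (m * m : ℕ)]) (α B : ℕ) :
    ((Finset.range m).filter fun v => α ≤ f v % (m * m) ∧ f v % (m * m) < α + m * B).card
      ≤ B + Int.gcd g m := by
  set D := Int.gcd g m with hD
  have hDpos : 0 < D := Int.gcd_pos_of_ne_zero_right _ (by exact_mod_cast hm.ne')
  have hDm : D ∣ m := by exact_mod_cast Int.gcd_dvd_right g (m : ℤ)
  obtain ⟨m', hm'⟩ := hDm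
  have hm'pos : 0 < m' := by
    rcases Nat.eq_zero_or_pos m' with rfl | h
    · simp at hm'; omega
    · exact h
  have hDg : (D : ℤ) ∣ g := Int.gcd_dvd_left g (m : ℤ)
  have hmod : ∀ v, ((f v % (m * m) : ℕ) : ℤ) ≡ c + m * (v * g) [ZMOD (m * m : ℕ)] := by
    intro v
    rw [Int.natCast_mod]
    exact (Int.mod_modEq _ _).trans (hf v)
  -- All values agree modulo `m * D`, so the first coordinate recovers the value. The value fixes
  -- `v` modulo `m' = m / D`, and the second coordinate then recovers `v`.
  calc _ ≤ (Finset.range (B / D + 1) ×ˢ Finset.range D).card := by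
        refine Finset.card_le_card_of_injOn
          (fun v => ((f v % (m * m) - α) / (m * D), v / m')) ?_ ?_
        · intro v hv
          simp only [Finset.coe_filter, Finset.mem_range, Set.mem_ofPred_eq] at hv
          simp only [Finset.coe_product, Finset.coe_range, Set.mem_prod, Set.mem_Iio]
          refine ⟨?_, Nat.div_lt_of_lt_mul (by rw [mul_comm, ← hm']; exact hv.1)⟩
          rw [Nat.lt_succ_iff, ← Nat.div_div_eq_div_mul]
          exact Nat.div_le_div_right (Nat.div_le_of_le_mul (by omega))
        · intro v hv w hw hvw
          simp only [Finset.coe_filter, Finset.mem_range, Set.mem_ofPred_eq] at hv hw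
          simp only [Prod.mk.injEq] at hvw
          obtain ⟨h1, h2⟩ := hvw
          have hz : ∀ v, ((f v % (m * m) : ℕ) : ℤ) ≡ c [ZMOD (m * D : ℕ)] := by
            intro v
            have h3 : ((m * D : ℕ) : ℤ) ∣ ((m * m : ℕ) : ℤ) := by
              exact_mod_cast Nat.mul_dvd_mul_left m ⟨m', hm'⟩
            refine ((hmod v).of_dvd h3).trans ?_
            rw [Int.modEq_iff_dvd]
            have : ((m * D : ℕ) : ℤ) ∣ m * (v * g) := by
              push_cast
              exact mul_dvd_mul_left _ (hDg.mul_left _)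
            simpa using this
          have h4 : f v % (m * m) ≡ f w % (m * m) [MOD m * D] :=
            Int.natCast_modEq_iff.1 ((hz v).trans (hz w).symm)
          have h5 : f v % (m * m) - α ≡ f w % (m * m) - α [MOD m * D] := by
            apply Nat.ModEq.add_right_cancel' α
            rwa [Nat.sub_add_cancel hv.2.1, Nat.sub_add_cancel hw.2.1]
          have h6 : f v % (m * m) - α = f w % (m * m) - α := by
            rw [← Nat.div_add_mod (f v % (m * m) - α) (m * D),
              ← Nat.div_add_mod (f w % (m * m) - α) (m * D), h1, h5]
          have h7 : f v % (m * m) = f w % (m * m) := by omega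
          have h8 : (m : ℤ) * (v * g) ≡ m * (w * g) [ZMOD (m * m : ℕ)] := by
            have := (hmod v).symm.trans ((congrArg (fun x : ℕ => (x : ℤ)) h7 ▸ hmod w))
            exact Int.ModEq.add_left_cancel' c this
          have h9 : (v : ℤ) * g ≡ w * g [ZMOD m] := by
            rw [Nat.cast_mul] at h8
            exact h8.mul_left_cancel' (by exact_mod_cast hm.ne')
          have h10 := h9.cancel_right_div_gcd (by exact_mod_cast hm)
          have h11 : (m : ℤ) / (Int.gcd (m : ℤ) g : ℤ) = m' := by
            rw [Int.gcd_comm, ← hD]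
            nth_rw 1 [hm']
            push_cast
            exact Int.mul_ediv_cancel_left _ (by exact_mod_cast hDpos.ne')
          rw [h11] at h10
          have h12 : v ≡ w [MOD m'] := Int.natCast_modEq_iff.1 h10
          rw [← Nat.div_add_mod v m', ← Nat.div_add_mod w m', h2, h12]
    _ = (B / D + 1) * D := by simp
    _ ≤ B + D := by rw [add_mul, one_mul]; exact Nat.add_le_add_right (Nat.div_mul_le_self _ _) _

/-- The numbers with `q` digits in base `K`, all of them different from `c₀`. -/
def avoiders (K c₀ q : ℕ) : Finset ℕ :=
  (Finset.range (K ^ q)).filter fun y => ∀ i < q, y / K ^ i % K ≠ c₀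

theorem card_avoiders_le {K c₀ : ℕ} (hc : c₀ < K) (q : ℕ) :
    (avoiders K c₀ q).card ≤ (K - 1) ^ q := by
  induction q with
  | zero => exact (Finset.card_filter_le _ _).trans (by simp)
  | succ q ih =>
    calc (avoiders K c₀ (q + 1)).card
        ≤ (avoiders K c₀ q ×ˢ (Finset.range K).erase c₀).card := by
          refine Finset.card_le_card_of_injOn (fun y => (y / K, y % K)) ?_ ?_
          · intro y hy
            simp only [avoiders, Finset.coe_filter, Finset.mem_range, Set.mem_ofPred_eq] at hy
            simp only [avoiders, Finset.coe_product, Set.mem_prod, Finset.coe_filter,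
              Finset.mem_range, Set.mem_ofPred_eq, Finset.mem_coe, Finset.mem_erase]
            refine ⟨⟨Nat.div_lt_of_lt_mul (by rw [← pow_succ']; exact hy.1), fun i hi => ?_⟩,
              ?_, Nat.mod_lt _ (by omega)⟩
            · rw [Nat.div_div_eq_div_mul, ← pow_succ']
              exact hy.2 (i + 1) (by omega)
            · simpa using hy.2 0 (by omega)
          · intro x _ y _ hxy
            simp only [Prod.mk.injEq] at hxy
            rw [← Nat.div_add_mod x K, ← Nat.div_add_mod y K, hxy.1, hxy.2]
      _ ≤ (K - 1) ^ (q + 1) := by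
          rw [Finset.card_product, Finset.card_erase_of_mem (Finset.mem_range.2 hc),
            Finset.card_range, pow_succ]
          exact Nat.mul_le_mul_right _ ih

/-- The gcd contains fewer than `t` factors `p`, so its cofactor in `k ^ j` is divisible by `p ^ (k
* s)`, which is at least `2 ^ (k * s) ≥ k ^ s`. -/
theorem gcd_pow_le {k p t s j : ℕ} {g : ℤ} (hk : 0 < k) (hp : p.Prime) (hpk : p ∣ k)
    (hg : ¬ (p : ℤ) ^ t ∣ g) (hj : t + k * s ≤ j) : Int.gcd g (k ^ j : ℕ) ≤ k ^ (j - s) := by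
  have hsj : s ≤ j := (Nat.le_mul_of_pos_left s hk).trans ((Nat.le_add_left _ _).trans hj)
  set D := Int.gcd g (k ^ j : ℕ) with hD
  obtain ⟨n, hn⟩ : D ∣ k ^ j := by exact_mod_cast Int.gcd_dvd_right g ((k ^ j : ℕ) : ℤ)
  have hpD : ¬ p ^ t ∣ D := fun h =>
    hg (by exact_mod_cast (Int.natCast_dvd_natCast.2 h).trans (Int.gcd_dvd_left g _))
  have hpn : p ^ (k * s) ∣ n := by
    apply hp.prime.pow_dvd_right_of_not_pow_dvd_left hpD
    rw [← hn]
    exact (pow_dvd_pow p (by omega)).trans (pow_dvd_pow_of_dvd hpk j)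
  have hn0 : 0 < n := Nat.pos_of_ne_zero (by rintro rfl; simp at hn; omega)
  have hks : k ^ s ≤ n := calc
    k ^ s ≤ (2 ^ k) ^ s := Nat.pow_le_pow_left Nat.lt_two_pow_self.le s
    _ = 2 ^ (k * s) := (pow_mul 2 k s).symm
    _ ≤ p ^ (k * s) := Nat.pow_le_pow_left hp.two_le _
    _ ≤ n := Nat.le_of_dvd hn0 hpn
  refine Nat.le_of_mul_le_mul_right (c := k ^ s) ?_ (pow_pos hk s)
  calc D * k ^ s ≤ D * n := Nat.mul_le_mul_left _ hks
    _ = k ^ (j - s) * k ^ s := by rw [← hn, ← pow_add, Nat.sub_add_cancel hsj]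

/-- The quotient consists of the top `L * q` of the last `2j` digits, viewed as `q` digits in base
`k ^ L`. -/
theorem mem_avoiders_of_not_hasBlock {k L c₀ q j N : ℕ} (hk : 0 < k) (hj : L * q ≤ j)
    (h : ¬ HasBlock k L c₀ (j + j) N) :
    N % (k ^ j * k ^ j) / (k ^ j * k ^ (j - L * q)) ∈ avoiders (k ^ L) c₀ q := by
  have hm : k ^ j * k ^ j = k ^ j * k ^ (j - L * q) * k ^ (L * q) := by
    rw [mul_assoc, ← pow_add k (j - L * q), Nat.sub_add_cancel hj]
  rw [hm, Nat.mod_mul_right_div_self, avoiders, Finset.mem_filter, Finset.mem_range, ← pow_mul]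
  refine ⟨Nat.mod_lt _ (pow_pos hk _), fun i hi heq => h ⟨j + (j - L * q) + L * i, ?_, ?_⟩⟩
  · have : L * (i + 1) ≤ L * q := Nat.mul_le_mul_left L hi
    rw [mul_add, mul_one] at this
    omega
  · have hsplit : k ^ (L * q) = k ^ (L * i) * k ^ (L * (q - i)) := by
      rw [← pow_add, ← mul_add, Nat.add_sub_cancel' hi.le]
    rw [← pow_mul, hsplit, Nat.mod_mul_right_div_self,
      Nat.mod_mod_of_dvd _ (pow_dvd_pow k (Nat.le_mul_of_pos_right L (by omega))),
      Nat.div_div_eq_div_mul] at heq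
    rw [← heq, pow_add, pow_add]

/-! ### Values of a polynomial that miss the block -/

-- Each pattern of top digits avoiding the block confines the value to an interval of length `m *
-- B`, which the progression meets at most `B + gcd ≤ 2 * B` times.
open Classical in
open Polynomial in
theorem card_not_hasBlock_progression_le {k L c₀ p t q j u : ℕ} (hk : 0 < k) (hc : c₀ < k ^ L)
    (hp : p.Prime) (hpk : p ∣ k) {Q : ℤ[X]} {f : ℕ → ℕ} (hf : ∀ n : ℕ, (f n : ℤ) = Q.eval (n : ℤ))
    (hu : ¬ (p : ℤ) ^ t ∣ (derivative Q).eval (u : ℤ)) (hj : t + k * (L * q) ≤ j) :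
    ((Finset.range (k ^ j)).filter fun v => ¬ HasBlock k L c₀ (j + j) (f (u + k ^ j * v))).card
      ≤ (k ^ L - 1) ^ q * (2 * k ^ (j - L * q)) := by
  have hsj : L * q ≤ j :=
    (Nat.le_mul_of_pos_left _ hk).trans ((Nat.le_add_left _ _).trans hj)
  set m := k ^ j with hm
  set B := k ^ (j - L * q) with hB
  have hmpos : 0 < m := pow_pos hk j
  have hBpos : 0 < B := pow_pos hk _
  have hlin : ∀ v : ℕ, (f (u + m * v) : ℤ) ≡
      Q.eval (u : ℤ) + m * (v * (derivative Q).eval (u : ℤ)) [ZMOD (m * m : ℕ)] := by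
    intro v
    -- The quadratic remainder of the Taylor expansion is a multiple of `m ^ 2`.
    obtain ⟨e, he⟩ := Q.binomExpansion (u : ℤ) ((m : ℤ) * v)
    rw [hf]
    push_cast
    rw [he]
    refine (Int.modEq_iff_dvd.2 ⟨-(e * v ^ 2), ?_⟩)
    ring
  refine le_trans ?_ (Nat.mul_le_mul_right _ (card_avoiders_le hc q))
  refine le_trans (Finset.card_le_card (t := (avoiders (k ^ L) c₀ q).biUnion fun y =>
    (Finset.range m).filter fun v => m * B * y ≤ f (u + m * v) % (m * m) ∧
      f (u + m * v) % (m * m) < m * B * y + m * B) ?_) (Finset.card_biUnion_le_card_mul _ _ _ ?_)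
  · intro v hv
    rw [Finset.mem_filter] at hv
    rw [Finset.mem_biUnion]
    refine ⟨_, mem_avoiders_of_not_hasBlock hk hsj hv.2, Finset.mem_filter.2 ⟨hv.1, ?_, ?_⟩⟩
    · exact Nat.mul_div_le _ _
    · exact Nat.lt_mul_div_succ _ (Nat.mul_pos hmpos hBpos)
  · intro y _
    refine (card_filter_progression_le hmpos (fun v => f (u + m * v)) _ _ hlin _ B).trans ?_
    have := gcd_pow_le hk hp hpk hu hj
    rw [← hm, ← hB] at this
    omega

-- The first term pays for the `u` at which `Q'(u)` is too divisible by `p`, where all `v` are given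
-- up; the second bounds the loss over the remaining `u`.
open Classical in
open Polynomial in
theorem card_not_hasBlock_le {k L c₀ p r h d q j : ℕ} (hk : 0 < k) (hc : c₀ < k ^ L)
    (hp : p.Prime) (hpk : p ∣ k) {Q : ℤ[X]} {f : ℕ → ℕ} (hf : ∀ n : ℕ, (f n : ℤ) = Q.eval (n : ℤ))
    (hd : Q.natDegree ≤ d) (hr : ¬ C ((p : ℤ) ^ r) ∣ derivative Q) (hhj : h ≤ j)
    (hj : r + h * d + k * (L * q) ≤ j) :
    (((Finset.range (k ^ j * k ^ j)).filter fun n => ¬ HasBlock k L c₀ (j + j) (f n)).card : ℝ)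
      ≤ (d * (1 / 2) ^ h + 2 * (1 - 1 / k ^ L) ^ q) * (k ^ j * k ^ j : ℕ) := by
  set m := k ^ j with hm
  have hmpos : 0 < m := pow_pos hk j
  set Z := (Finset.range m).filter fun u : ℕ => (p : ℤ) ^ (r + h * d) ∣ (derivative Q).eval (u : ℤ)
    with hZ
  set V : ℕ → Finset ℕ := fun u =>
    (Finset.range m).filter fun v => ¬ HasBlock k L c₀ (j + j) (f (u + m * v)) with hV
  have hsj : L * q ≤ j :=
    (Nat.le_mul_of_pos_left _ hk).trans ((Nat.le_add_left _ _).trans hj)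
  have hsum : ((Finset.range (m * m)).filter fun n => ¬ HasBlock k L c₀ (j + j) (f n)).card
      ≤ ∑ u ∈ Finset.range m, (V u).card := by
    rw [← Finset.card_sigma]
    refine Finset.card_le_card_of_injOn (fun n => ⟨n % m, n / m⟩) ?_ ?_
    · intro n hn
      simp only [Finset.coe_filter, Finset.mem_range, Set.mem_ofPred_eq] at hn
      simp only [hV, Finset.coe_sigma, Set.mem_sigma_iff, Finset.mem_coe, Finset.mem_range,
        Finset.mem_filter, Nat.mod_add_div]
      exact ⟨Nat.mod_lt _ hmpos, Nat.div_lt_of_lt_mul hn.1, hn.2⟩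
    · intro x _ y _ hxy
      simp only [Sigma.mk.injEq, heq_eq_eq] at hxy
      rw [← Nat.div_add_mod x m, ← Nat.div_add_mod y m, hxy.1, hxy.2]
  have hVle : ∀ u ∈ Finset.range m, (V u).card ≤
      (if u ∈ Z then m else 0) + (k ^ L - 1) ^ q * (2 * k ^ (j - L * q)) := by
    intro u hu
    split_ifs with huZ
    · exact ((Finset.card_filter_le _ _).trans (Finset.card_range m).le).trans
        (Nat.le_add_right _ _)
    · rw [zero_add]
      exact card_not_hasBlock_progression_le hk hc hp hpk hf
        (fun hdvd => huZ (Finset.mem_filter.2 ⟨hu, hdvd⟩)) hj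
  have htotal := hsum.trans (Finset.sum_le_sum hVle)
  rw [Finset.sum_add_distrib, ← Finset.sum_filter, Finset.sum_const, Finset.sum_const,
    Finset.card_range, smul_eq_mul, smul_eq_mul, Finset.filter_mem_eq_inter,
    Finset.inter_eq_right.2 (Finset.filter_subset _ _)] at htotal
  have hZcard : Z.card * p ^ h ≤ d * m :=
    card_filter_pow_dvd_eval_le hp r h d m
      ((natDegree_derivative_le Q).trans ((Nat.sub_le _ _).trans hd)) hr
      ((pow_dvd_pow_of_dvd hpk h).trans (pow_dvd_pow k hhj))
  have hZreal : (Z.card : ℝ) ≤ d * (1 / 2) ^ h * m := by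
    have h2 : Z.card * 2 ^ h ≤ d * m :=
      (Nat.mul_le_mul_left _ (Nat.pow_le_pow_left hp.two_le h)).trans hZcard
    have h2' : (Z.card : ℝ) * 2 ^ h ≤ d * m := by exact_mod_cast h2
    rw [one_div, inv_pow, mul_right_comm, ← div_eq_mul_inv, le_div_iff₀ (by positivity)]
    exact h2'
  have hA : (((k ^ L - 1) ^ q * (2 * k ^ (j - L * q)) : ℕ) : ℝ) = 2 * (1 - 1 / k ^ L) ^ q * m := by
    have hkL : 1 ≤ k ^ L := pow_pos hk L
    have hk' : (k : ℝ) ≠ 0 := by exact_mod_cast hk.ne'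
    have hmk : (m : ℝ) = k ^ (j - L * q) * (k ^ L) ^ q := by
      rw [hm, ← pow_mul, ← pow_add, Nat.sub_add_cancel hsj]
      push_cast
      rfl
    rw [hmk]
    push_cast [Nat.cast_sub hkL]
    rw [show (1 : ℝ) - 1 / k ^ L = (k ^ L - 1) / k ^ L by field_simp, div_pow]
    field_simp
  calc _ ≤ ((Z.card * m + m * ((k ^ L - 1) ^ q * (2 * k ^ (j - L * q))) : ℕ) : ℝ) := by
        exact_mod_cast htotal
    _ = Z.card * m + m * (2 * (1 - 1 / k ^ L) ^ q * m) := by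
        rw [Nat.cast_add, Nat.cast_mul, Nat.cast_mul, hA]
    _ ≤ d * (1 / 2) ^ h * m * m + m * (2 * (1 - 1 / k ^ L) ^ q * m) := by gcongr
    _ = _ := by push_cast; ring

/-! ### Normalizing the polynomial -/

open Polynomial in
/-- Splitting off the digits in which a polynomial is constant. -/
theorem exists_eq_C_add_C_pow_mul {k d : ℕ} (hk : 2 ≤ k) {P : ℤ[X]}
    (hP : P ∈ natValuedPolynomials d) (hdeg : P.natDegree ≠ 0) :
    ∃ (M c : ℕ) (Q : ℤ[X]), c < k ^ M ∧ P = C (c : ℤ) + C ((k : ℤ) ^ M) * Q ∧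
      Q ∈ natValuedPolynomials d ∧ ∃ i, i ≠ 0 ∧ ¬ (k : ℤ) ∣ Q.coeff i := by
  set R := P - C (P.coeff 0) with hR
  have hR0 : R.coeff 0 = 0 := by simp [hR]
  have hRne : R ≠ 0 := by
    intro h
    apply hdeg
    rw [sub_eq_zero.1 h, natDegree_C]
  have hcont : R.content.natAbs ≠ 0 := by
    rwa [Int.natAbs_ne_zero, Ne, content_eq_zero_iff]
  -- `M` is the largest exponent with `k ^ M` dividing every nonconstant coefficient of `P`.
  obtain ⟨M, g, hg, hM⟩ := Nat.exists_eq_pow_mul_and_not_dvd hcont k (by omega)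
  have hkM : (0 : ℤ) < (k : ℤ) ^ M := by positivity
  have hdvdR : C ((k : ℤ) ^ M) ∣ R := by
    rw [← dvd_content_iff_C_dvd, ← Int.dvd_natAbs, hM]
    exact ⟨g, by push_cast; rfl⟩
  obtain ⟨R', hR'⟩ := hdvdR
  have hR'0 : R'.coeff 0 = 0 := by
    rw [hR', coeff_C_mul] at hR0
    exact (mul_eq_zero.1 hR0).resolve_left hkM.ne'
  have hnot : ¬ C (k : ℤ) ∣ R' := by
    rintro ⟨R'', hR''⟩
    apply hg
    have h1 : C ((k : ℤ) ^ M * k) ∣ R := by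
      rw [hR', hR'', C_mul, ← mul_assoc]
      exact dvd_mul_right _ _
    rw [← dvd_content_iff_C_dvd, ← Int.dvd_natAbs, hM] at h1
    have h2 : k ^ M * k ∣ k ^ M * g := by exact_mod_cast h1
    exact (Nat.mul_dvd_mul_iff_left (by positivity)).1 h2
  have hPeq : P = C (P.coeff 0 % (k : ℤ) ^ M) +
      C ((k : ℤ) ^ M) * (C (P.coeff 0 / (k : ℤ) ^ M) + R') := by
    rw [mul_add, ← hR', ← C_mul, ← add_assoc, ← C_add, Int.emod_add_mul_ediv, hR]
    ring
  have hmod0 : 0 ≤ P.coeff 0 % (k : ℤ) ^ M := Int.emod_nonneg _ hkM.ne'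
  have hmodlt : P.coeff 0 % (k : ℤ) ^ M < (k : ℤ) ^ M := Int.emod_lt_of_pos _ hkM
  refine ⟨M, (P.coeff 0 % (k : ℤ) ^ M).toNat, C (P.coeff 0 / (k : ℤ) ^ M) + R', ?_, ?_, ⟨?_, ?_⟩, ?_⟩
  · zify
    rwa [Int.toNat_of_nonneg hmod0]
  · rw [Int.toNat_of_nonneg hmod0]
    exact hPeq
  · refine (degree_add_le _ _).trans (max_le (degree_C_le.trans (by exact_mod_cast Nat.zero_le d)) ?_)
    have h1 : R.degree ≤ d :=
      (degree_sub_le _ _).trans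
        (max_le hP.1 (degree_C_le.trans (by exact_mod_cast Nat.zero_le d)))
    rwa [hR', degree_C_mul hkM.ne'] at h1
  -- A value `Q(n) ≤ -1` would give `P(n) ≤ c - k ^ M < 0`.
  · intro n
    have h1 := hP.2 n
    rw [hPeq, eval_add, eval_mul, eval_C, eval_C] at h1
    by_contra hneg
    push Not at hneg
    have : (k : ℤ) ^ M * (C (P.coeff 0 / (k : ℤ) ^ M) + R').eval (n : ℤ) ≤ (k : ℤ) ^ M * (-1) :=
      mul_le_mul_of_nonneg_left (by omega) hkM.le
    linarith
  · by_contra hcon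
    push Not at hcon
    apply hnot
    rw [C_dvd_iff_dvd_coeff]
    intro i
    rcases eq_or_ne i 0 with rfl | hi
    · rw [hR'0]; exact dvd_zero _
    · have h1 := hcon i hi
      rwa [coeff_add, coeff_C_of_ne_zero hi, zero_add] at h1

-- Some prime power `p ^ e ∣ k` does not divide the coefficient, and `e ≤ k`. Differentiation
-- multiplies it by `i ≤ d < p ^ d`. Thus the exponent `k + d` is uniform in `Q`.
open Polynomial in
theorem exists_prime_not_dvd_derivative {k d : ℕ} (hk : 2 ≤ k) {Q : ℤ[X]} (hd : Q.natDegree ≤ d)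
    {i : ℕ} (hi : i ≠ 0) (hQ : ¬ (k : ℤ) ∣ Q.coeff i) :
    ∃ p : ℕ, p.Prime ∧ p ∣ k ∧ ¬ C ((p : ℤ) ^ (k + d)) ∣ derivative Q := by
  have hid : i ≤ d := by
    refine (le_natDegree_of_ne_zero fun h => hQ ?_).trans hd
    rw [h]
    exact dvd_zero _
  rw [← Int.dvd_natAbs, Int.natCast_dvd_natCast, Nat.dvd_iff_prime_pow_dvd_dvd] at hQ
  push Not at hQ
  obtain ⟨p, e, hp, hpk, hpQ⟩ := hQ
  have he : e ≠ 0 := by rintro rfl; simp at hpQ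
  have hek : e ≤ k :=
    (Nat.lt_pow_self hp.one_lt).le.trans (Nat.le_of_dvd (by omega) hpk)
  refine ⟨p, hp, (dvd_pow_self p he).trans hpk, fun h => hpQ ?_⟩
  have h1 := (C_dvd_iff_dvd_coeff _ _).1 h (i - 1)
  rw [coeff_derivative, Nat.sub_add_cancel (Nat.pos_of_ne_zero hi)] at h1
  rw [← Int.natCast_dvd_natCast, Int.dvd_natAbs, Nat.cast_pow]
  have hpi : ¬ (p : ℤ) ^ d ∣ ((i - 1 : ℕ) : ℤ) + 1 := by
    have h2 : ((i - 1 : ℕ) : ℤ) + 1 = (i : ℕ) := by omega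
    rw [h2]
    intro h3
    have h4 : p ^ d ≤ i := Nat.le_of_dvd (Nat.pos_of_ne_zero hi) (by exact_mod_cast h3)
    exact absurd (Nat.lt_pow_self hp.one_lt (n := d)) (by omega)
  rw [mul_comm] at h1
  exact (pow_dvd_pow _ hek).trans
    ((Nat.prime_iff_prime_int.1 hp).pow_dvd_right_of_not_pow_dvd_left hpi h1)

/-! ### Counting words and the growth rate -/

/-- The words `F (S (b ℓ))`, `ℓ < H`, where `b` is `K`-periodic modulo `K` and takes at most `E`
values per period that do not satisfy `G`. -/
def periodicWords {σ : Type*} (S : ℕ → σ) (G : ℕ → Prop) (K E H : ℕ) : Set (Fin H → σ) :=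
  {w | ∃ (F : σ → σ) (b : ℕ → ℕ), (∀ n, b n % K = b (n % K) % K) ∧
    {n | n < K ∧ ¬ G (b n)}.ncard ≤ E ∧ ∀ ℓ : Fin H, w ℓ = F (S (b ℓ))}

-- A word is determined by `F`, by `b` modulo `K`, and by its letters at the positions failing `G`;
-- `F` and `b` modulo `K` already fix those positions.
open Classical in
theorem ncard_periodicWords_le {σ : Type*} [Finite σ] {S : ℕ → σ} {G : ℕ → Prop} {K : ℕ}
    (hK : 0 < K) (hG : ∀ N N', G N → N % K = N' % K → G N' ∧ S N = S N') (E H : ℕ) :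
    (periodicWords S G K E H).ncard ≤
      Nat.card σ ^ ((H / K + 1) * E) * Nat.card ((σ → σ) × (Fin K → Fin K)) := by
  have := Fintype.ofFinite σ
  rcases isEmpty_or_nonempty σ with hσ | hσ
  · exact hσ.elim (S 0)
  have hGiff : ∀ N, G N ↔ G (N % K) := fun N =>
    ⟨fun h => (hG N _ h (Nat.mod_mod _ _).symm).1, fun h => (hG _ N h (Nat.mod_mod _ _)).1⟩
  rw [Set.ncard_eq_toFinset_card' (periodicWords S G K E H), Nat.card_eq_fintype_card,
    Nat.card_eq_fintype_card]
  choose! F b hb hE hw using fun w (hw : w ∈ periodicWords S G K E H) => hw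
  let code : (Fin H → σ) → (σ → σ) × (Fin K → Fin K) := fun w =>
    (F w, fun r => ⟨b w r % K, Nat.mod_lt _ hK⟩)
  refine (Finset.card_le_mul_card_image (f := code) _ (Fintype.card σ ^ ((H / K + 1) * E)) ?_).trans
    (Nat.mul_le_mul_left _ (Finset.card_le_univ _))
  intro y hy
  obtain ⟨w₀, hw₀, rfl⟩ := Finset.mem_image.1 hy
  rw [Set.mem_toFinset] at hw₀
  set T : Finset (Fin H) := Finset.univ.filter fun ℓ => ¬ G (b w₀ ℓ) with hT
  have hTcard : T.card ≤ (H / K + 1) * E := by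
    have hfin : {n | n < K ∧ ¬ G (b w₀ n)}.Finite := (Set.finite_lt_nat K).subset fun n hn => hn.1
    refine le_trans ?_ (Nat.mul_le_mul_left _ (hE w₀ hw₀))
    rw [Set.ncard_eq_toFinset_card _ hfin, ← Finset.card_range (H / K + 1), ← Finset.card_product]
    refine Finset.card_le_card_of_injOn (fun ℓ => ((ℓ : ℕ) / K, (ℓ : ℕ) % K)) ?_ ?_
    · intro ℓ hℓ
      have h1 : ¬ G (b w₀ ℓ) := (Finset.mem_filter.1 hℓ).2
      simp only [Finset.coe_product, Set.mem_prod, Finset.mem_coe, Finset.mem_range,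
        Set.Finite.mem_toFinset]
      refine ⟨Nat.lt_succ_of_le (Nat.div_le_div_right ℓ.2.le), Nat.mod_lt _ hK, ?_⟩
      rwa [hGiff, ← hb w₀ hw₀, ← hGiff]
    · intro x _ y _ hxy
      simp only [Prod.mk.injEq] at hxy
      ext
      rw [← Nat.div_add_mod (x : ℕ) K, ← Nat.div_add_mod (y : ℕ) K, hxy.1, hxy.2]
  refine le_trans ?_ (Nat.pow_le_pow_right Fintype.card_pos hTcard)
  have hcard : Fintype.card σ ^ T.card = (Finset.univ : Finset (T → σ)).card := by simp
  rw [hcard]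
  refine Finset.card_le_card_of_injOn (fun w ℓ => w ℓ) (fun _ _ => Finset.mem_coe.2 (Finset.mem_univ _)) ?_
  have key : ∀ w ∈ periodicWords S G K E H, code w = code w₀ → ∀ ℓ ∉ T, w ℓ = w₀ ℓ := by
    intro w hwmem hcode ℓ hℓ
    have hgood : G (b w₀ ℓ) := by
      by_contra h
      exact hℓ (Finset.mem_filter.2 ⟨Finset.mem_univ _, h⟩)
    have h1 : F w = F w₀ := congrArg Prod.fst hcode
    have h2 : b w (ℓ % K) % K = b w₀ (ℓ % K) % K :=
      congrArg Fin.val (congrFun (congrArg Prod.snd hcode) ⟨ℓ % K, Nat.mod_lt _ hK⟩)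
    rw [hw w hwmem, hw w₀ hw₀, h1,
      (hG _ (b w ℓ) hgood (by rw [hb w₀ hw₀, hb w hwmem, h2])).2]
  intro w hw1 w' hw2 hww
  simp only [Finset.coe_filter, Set.mem_toFinset, Set.mem_ofPred_eq] at hw1 hw2
  funext ℓ
  by_cases hℓ : ℓ ∈ T
  · exact congrFun hww ⟨ℓ, hℓ⟩
  · rw [key w hw1.1 hw1.2 ℓ hℓ, key w' hw2.1 hw2.2 ℓ hℓ]

theorem tendsto_log_div_of_le_pow {u : ℕ → ℕ} {s : ℕ} (hs : 1 ≤ s)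
    (h : ∀ δ : ℝ, 0 < δ → ∃ B K E : ℕ, 0 < K ∧ (E : ℝ) ≤ δ * K ∧
      ∀ H, u H ≤ B * s ^ ((H / K + 1) * E)) :
    Filter.Tendsto (fun H : ℕ => (1 / (H : ℝ)) * Real.log (u H)) Filter.atTop (nhds 0) := by
  have hlogs : 0 ≤ Real.log s := Real.log_natCast_nonneg s
  have hnonneg : ∀ H : ℕ, 0 ≤ (1 / (H : ℝ)) * Real.log (u H) := fun H =>
    mul_nonneg (by positivity) (Real.log_natCast_nonneg _)
  refine tendsto_order.2 ⟨fun b hb => Filter.Eventually.of_forall fun H => hb.trans_le (hnonneg H),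
    fun ε hε => ?_⟩
  obtain ⟨B, K, E, hK, hE, hB⟩ := h (ε / (2 * (Real.log s + 1))) (by positivity)
  set δ := ε / (2 * (Real.log s + 1)) with hδ
  have hδs : δ * Real.log s ≤ ε / 2 := by
    rw [hδ, div_mul_eq_mul_div, div_le_div_iff₀ (by positivity) (by positivity)]
    nlinarith
  set c := Real.log (B + 1) + K * (ε / 2) with hc
  have hlog : ∀ H : ℕ, Real.log (u H) ≤ c + H * (ε / 2) := by
    intro H
    -- Using `B + 1` keeps the logarithm nonnegative even if `B = 0`.
    have h1 : (u H : ℝ) ≤ (B + 1) * s ^ ((H / K + 1) * E) := by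
      have : (u H : ℝ) ≤ B * s ^ ((H / K + 1) * E) := by exact_mod_cast hB H
      exact this.trans (by gcongr; linarith)
    have hs0 : (0 : ℝ) < s := by exact_mod_cast hs
    have hB1 : (0 : ℝ) ≤ Real.log (B + 1) := Real.log_nonneg (by linarith [Nat.cast_nonneg (α := ℝ) B])
    have hHK : ((H / K + 1 : ℕ) : ℝ) * E ≤ (H + K) * δ := by
      have h2 : ((H / K : ℕ) : ℝ) ≤ H / K := Nat.cast_div_le
      have hK0 : (0 : ℝ) < K := by exact_mod_cast hK
      calc ((H / K + 1 : ℕ) : ℝ) * E ≤ (H / K + 1) * (δ * K) := by push_cast; gcongr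
        _ = (H + K) * δ := by field_simp
    have hbound : Real.log (B + 1) + ((H / K + 1 : ℕ) : ℝ) * E * Real.log s ≤ c + H * (ε / 2) := by
      have h3 : ((H / K + 1 : ℕ) : ℝ) * E * Real.log s ≤ (H + K) * δ * Real.log s :=
        mul_le_mul_of_nonneg_right hHK hlogs
      have h4 : ((H : ℝ) + K) * δ * Real.log s ≤ (H + K) * (ε / 2) := by
        rw [mul_assoc]
        gcongr
      rw [hc]
      linarith
    -- For `u H = 0` the convention `Real.log 0 = 0` applies.
    rcases Nat.eq_zero_or_pos (u H) with h0 | h0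
    · rw [h0, Nat.cast_zero, Real.log_zero]
      positivity
    · refine (Real.log_le_log (by exact_mod_cast h0) h1).trans ?_
      rw [Real.log_mul (by positivity) (by positivity), Real.log_pow]
      exact_mod_cast hbound
  have hlim : Filter.Tendsto (fun H : ℕ => c / (H : ℝ)) Filter.atTop (nhds 0) :=
    tendsto_const_div_atTop_nhds_zero_nat c
  filter_upwards [hlim.eventually_lt_const (half_pos hε), Filter.eventually_gt_atTop 0] with H h1 h2
  have hH : (0 : ℝ) < H := by exact_mod_cast h2
  calc (1 / (H : ℝ)) * Real.log (u H) ≤ (1 / (H : ℝ)) * (c + H * (ε / 2)) := by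
        gcongr
        exact hlog H
    _ = c / H + ε / 2 := by field_simp
    _ < ε := by linarith

theorem exists_pow_add_pow_le {x : ℝ} (hx : 0 ≤ x) (hx1 : x < 1) (d : ℝ) {δ : ℝ} (hδ : 0 < δ) :
    ∃ h q : ℕ, d * (1 / 2) ^ h + 2 * x ^ q ≤ δ := by
  have h1 : Filter.Tendsto (fun n : ℕ => d * (1 / 2 : ℝ) ^ n + 2 * x ^ n) Filter.atTop
      (nhds (d * 0 + 2 * 0)) :=
    ((tendsto_pow_atTop_nhds_zero_of_lt_one (by norm_num) (by norm_num)).const_mul d).add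
      ((tendsto_pow_atTop_nhds_zero_of_lt_one hx hx1).const_mul 2)
  rw [mul_zero, mul_zero, add_zero] at h1
  obtain ⟨n, hn⟩ := (h1.eventually_lt_const hδ).exists
  exact ⟨n, n, hn.le⟩

/-! ### Assembling the proof -/

open Polynomial in
/-- Along a polynomial, the states are constant or form a periodic word with few exceptions. -/
theorem IsSynchronizedBy.comp_polynomial {σ : Type*} {k L c₀ d h q j E H : ℕ} {S : ℕ → σ}
    (hk : 2 ≤ k) (hS : IsSynchronizedBy k S L c₀) (hj : k + d + h * d + k * (L * q) + h ≤ j)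
    (hE : ∀ x : ℕ, (x : ℝ) ≤ (d * (1 / 2) ^ h + 2 * (1 - 1 / k ^ L) ^ q) * (k ^ j * k ^ j : ℕ) → x ≤ E)
    {P : ℤ[X]} (hP : P ∈ natValuedPolynomials d) :
    (fun ℓ : Fin H => S (P.eval ((ℓ : ℕ) : ℤ)).toNat) ∈
      periodicWords S (HasBlock k L c₀ (j + j)) (k ^ j * k ^ j) E H ∪
        Set.range (fun s _ => s) := by
  by_cases hdeg : P.natDegree = 0
  · right
    refine ⟨S (P.coeff 0).toNat, ?_⟩
    rw [eq_C_of_natDegree_eq_zero hdeg]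
    simp
  left
  obtain ⟨M, c, Q, hc, hPQ, hQ, i, hi, hik⟩ := exists_eq_C_add_C_pow_mul hk hP hdeg
  have hQd : Q.natDegree ≤ d := natDegree_le_of_degree_le hQ.1
  obtain ⟨p, hp, hpk, hpQ⟩ := exists_prime_not_dvd_derivative hk hQd hi hik
  obtain ⟨F, hF⟩ := hS.exists_append M c hc
  have hf : ∀ n : ℕ, (((Q.eval (n : ℤ)).toNat : ℕ) : ℤ) = Q.eval (n : ℤ) := fun n =>
    Int.toNat_of_nonneg (hQ.2 n)
  refine ⟨F, fun n => (Q.eval (n : ℤ)).toNat, fun n => ?_, hE _ ?_, fun ℓ => ?_⟩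
  · rw [← Nat.ModEq, Nat.modEq_iff_dvd, hf, hf]
    refine dvd_trans ?_ (sub_dvd_eval_sub _ _ Q)
    rw [← Nat.modEq_iff_dvd]
    exact (Nat.mod_modEq _ _).symm
  · classical
    have := card_not_hasBlock_le (h := h) (q := q) (j := j) (by omega) hS.lt hp hpk hf hQd hpQ
      (by omega) (by omega)
    convert this using 2
    rw [← Set.ncard_coe_finset]
    congr 1
    ext n
    simp
  · have h1 : (P.eval ((ℓ : ℕ) : ℤ)).toNat = k ^ M * (Q.eval ((ℓ : ℕ) : ℤ)).toNat + c := by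
      zify
      rw [Int.toNat_of_nonneg (hP.2 _), hf, hPQ]
      simp [add_comm]
    beta_reduce
    rw [h1, hF]

theorem mainTheorem8 {A : Type*} (k : ℕ) (hk : 2 ≤ k) (a : ℕ → A)
    (ha : IsSynchronizingAutomatic k hk a) (d : ℕ) :
    (∀ H : ℕ, (polynomialSubwords a d H).Finite) ∧
      Filter.Tendsto
        (fun H : ℕ => (1 / (H : ℝ)) * Real.log ((polynomialSubwords a d H).ncard : ℝ))
        Filter.atTop (nhds 0) := by
  obtain ⟨σ, hσ, S, out, L, c₀, hS, hout⟩ := ha.exists_isSynchronizedBy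
  have : Nonempty σ := ⟨S 0⟩
  set W : ∀ H : ℕ, Set (Fin H → σ) := fun H =>
    {w | ∃ P ∈ natValuedPolynomials d, w = fun ℓ : Fin H => S (P.eval ((ℓ : ℕ) : ℤ)).toNat} with hW
  have hsub : ∀ H, polynomialSubwords a d H ⊆ (fun w : Fin H → σ => out ∘ w) '' W H := by
    -- The shift by `n` is absorbed into the polynomial, which keeps its degree and its
    -- nonnegativity on `ℕ`.
    rintro H _ ⟨n, P, hP, rfl⟩
    refine ⟨_, ⟨P.comp (Polynomial.X + Polynomial.C (n : ℤ)), ⟨?_, fun m => ?_⟩, rfl⟩, ?_⟩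
    · refine Polynomial.degree_le_of_natDegree_le ?_
      rw [Polynomial.natDegree_comp, Polynomial.natDegree_X_add_C, mul_one]
      exact Polynomial.natDegree_le_of_degree_le hP.1
    · have := hP.2 (m + n)
      simpa [Polynomial.eval_comp] using this
    · funext ℓ
      simp [hout, Polynomial.eval_comp, add_comm]
  refine ⟨fun H => ((Set.toFinite (W H)).image _).subset (hsub H), ?_⟩
  refine tendsto_log_div_of_le_pow (s := Nat.card σ) Nat.card_pos fun δ hδ => ?_
  have hkL : (1 : ℝ) ≤ (k : ℝ) ^ L := one_le_pow₀ (by exact_mod_cast (by omega : 1 ≤ k))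
  obtain ⟨h, q, hhq⟩ := exists_pow_add_pow_le (x := 1 - 1 / (k : ℝ) ^ L)
    (sub_nonneg.2 ((div_le_one (by positivity)).2 hkL)) (sub_lt_self _ (by positivity)) d hδ
  -- The exponent `r = k + d` comes from `exists_prime_not_dvd_derivative`; the final `h` ensures `h
  -- ≤ j`.
  set j := k + d + h * d + k * (L * q) + h with hj
  set K := k ^ j * k ^ j with hK
  have hKpos : 0 < K := Nat.mul_pos (pow_pos (by omega) _) (pow_pos (by omega) _)
  have hword : ∀ H, W H ⊆ periodicWords S (HasBlock k L c₀ (j + j)) K ⌊δ * K⌋₊ H ∪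
      Set.range (fun s _ => s) := by
    rintro H _ ⟨P, hP, rfl⟩
    exact hS.comp_polynomial hk hj.ge
      (fun x hx => Nat.le_floor (hx.trans (mul_le_mul_of_nonneg_right hhq (Nat.cast_nonneg _)))) hP
  refine ⟨Nat.card ((σ → σ) × (Fin K → Fin K)) + Nat.card σ, K, ⌊δ * K⌋₊, hKpos,
    Nat.floor_le (by positivity), fun H => ?_⟩
  have hperiodic := ncard_periodicWords_le (S := S) (G := HasBlock k L c₀ (j + j)) hKpos
    (fun N N' hN hNN => by
      rw [hK, ← pow_add] at hNN
      exact ⟨hN.congr hNN, hS.eq_of_hasBlock (by omega) hN hNN⟩) ⌊δ * K⌋₊ H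
  have hconst : (Set.range (fun (s : σ) (_ : Fin H) => s)).ncard ≤ Nat.card σ := by
    rw [← Set.image_univ, ← Set.ncard_univ]
    exact Set.ncard_image_le
  have hpow : 1 ≤ Nat.card σ ^ ((H / K + 1) * ⌊δ * K⌋₊) := Nat.pow_pos Nat.card_pos
  calc (polynomialSubwords a d H).ncard
      ≤ (W H).ncard := (Set.ncard_le_ncard (hsub H) (Set.toFinite _)).trans Set.ncard_image_le
    _ ≤ _ := Set.ncard_le_ncard (hword H) (Set.toFinite _)
    _ ≤ _ := Set.ncard_union_le _ _
    _ ≤ _ := add_le_add hperiodic hconst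
    _ ≤ _ := by
        rw [add_mul (Nat.card ((σ → σ) × (Fin K → Fin K))), mul_comm (Nat.card σ ^ _)]
        exact Nat.add_le_add_left (Nat.le_mul_of_pos_right _ hpow) _
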